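/- **Conventions.** Let $P$ be a finite poset, $d = |P|$, and let $\hat P = P \cup \{\hat 0, \hat 1\}$ be $P$ with a new minimum $\hat 0$ and a new maximum $\hat 1$ adjoined. Let $\mathbf e_p$ ($p \in P$) be the standard basis of $\mathbb R^P \cong \mathbb R^d$ and put $\mathbf e_{\hat 0} = \mathbf e_{\hat 1} = 0$. For an edge $e = \{x,y\}$ of the Hasse diagram of $\hat P$ with $x < y$ let $\rho(e) = \mathbf e_x - \mathbf e_y$, and let $\mathcal Q_P \subset \mathbb R^P$ be the convex hull of all $\rho(e)$. A *Fano polytope* in $\mathbb R^d$ is a $d$-dimensional integral convex polytope whose only interior integer point is the origin. It is *$\mathbb Q$-factorial* (simplicial) if each of its proper faces is a simplex, and *smooth* if the vertices of each facet form a $\mathbb Z$-basis of $\mathbb Z^d$. A *path* is a sequence of distinct elements of $\hat P$ in which consecutive elements are joined by an edge of the Hasse diagram; a *cycle* is a path with at least three elements whose last and first elements are also joined by an edge (this closing step then counts as a step of the cycle). A path or cycle $\Gamma$ is *special* if it has as many ascending steps as descending steps. For a special path or cycle $\Gamma$ let $\mu_\Gamma$ be the unique function from its vertices to $\{0,1,2,\dots\}$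 that increases by $1$ along each ascending step, decreases by $1$ along each descending step, and has minimum value $0$. A cycle is *very special* if it is special and does not contain both $\hat 0$ and $\hat 1$. For $y \le z$ in $\hat P$ let $\operatorname{dist}(y,z)$ be the smallest length $s$ of a saturated chain $y = z_0 < z_1 < \cdots < z_s = z$ in $\hat P$, i.e. one in which each $z_{i+1}$ covers $z_i$ (so $\operatorname{dist}(y,y)=0$). **Theorem.** For every finite poset $P$ the following conditions are equivalent: (i) $\mathcal Q_P$ is a $\mathbb Q$-factorial Fano polytope; (ii) $\mathcal Q_P$ is a smooth Fano polytope; (iii) $\hat P$ has no very special cycle $C$ such that $$\mu_C(x) - \mu_C(y) \le \operatorname{dist}(y,x) \quad\text{for all vertices } x, y \text{ of } C \text{ with } y < x, \tag{1}$$ $$\mu_C(x) - \mu_C(y) \le \operatorname{dist}(\hat 0,x) + \operatorname{dist}(y,\hat 1) \quad\text{for all vertices } x, y \text{ of } C, \tag{2}$$ and no special path $\Gamma$ from $\hat 0$ to $\hat 1$ such that $$\mu_\Gamma(x) - \mu_\Gamma(y) \le \operatorname{dist}(y,x) \quad\text{for all vertices } x, y \text{ of } \Gamma \text{ with } y < x.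 \tag{3}$$ In particular, $\mathcal Q_P$ is smooth if and only if it is $\mathbb Q$-factorial. -/

import Mathlib

namespace PosetFano

section Polytopes

variable {ι : Type*}

/-- The integer vector `v ∈ ℤ^ι`, regarded as a point of `ℝ^ι`. -/
def toReal (v : ι → ℤ) : ι → ℝ := fun i => (v i : ℝ)

/-- `Q ⊂ ℝ^ι` is an integral convex polytope: the convex hull of finitely many integer points. -/
def IsIntegralPolytope (Q : Set (ι → ℝ)) : Prop :=
  ∃ S : Set (ι → ℤ), S.Finite ∧ Q = convexHull ℝ (toReal '' S)

/-- `Q ⊂ ℝ^ι` is a Fano polytope: an integral convex polytope such that the origin is the unique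
integer point in its interior. (In particular the interior is nonempty, so `Q` has full
dimension.) -/
def IsFano (Q : Set (ι → ℝ)) : Prop :=
  IsIntegralPolytope Q ∧ ∀ v : ι → ℤ, toReal v ∈ interior Q ↔ v = 0

/-- `F` is a simplex: the convex hull of a finite affinely independent set of points
(the empty set counts as the simplex of dimension `-1`). -/
def IsSimplex (F : Set (ι → ℝ)) : Prop :=
  ∃ s : Set (ι → ℝ), s.Finite ∧ AffineIndependent ℝ ((↑) : s → (ι → ℝ)) ∧ F = convexHull ℝ s

/-- `F` is a facet of the convex polytope `Q`: a nonempty face (an exposed face; all faces of a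
polytope are exposed) of dimension `dim Q - 1`. -/
def IsFacet (Q F : Set (ι → ℝ)) : Prop :=
  IsExposed ℝ Q F ∧ F.Nonempty ∧
    Module.finrank ℝ (vectorSpan ℝ F) + 1 = Module.finrank ℝ (vectorSpan ℝ Q)

/-- A `ℚ`-factorial Fano polytope: a simplicial Fano polytope, i.e. one each of whose
(proper) faces is a simplex. -/
def IsQFactorialFano (Q : Set (ι → ℝ)) : Prop :=
  IsFano Q ∧ ∀ F : Set (ι → ℝ), IsExposed ℝ Q F → F ≠ Q → IsSimplex F

/-- A smooth Fano polytope: a Fano polytope such that the vertices of each facet form a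
`ℤ`-basis of `ℤ^ι`. -/
def IsSmoothFano (Q : Set (ι → ℝ)) : Prop :=
  IsFano Q ∧ ∀ F : Set (ι → ℝ), IsFacet Q F →
    ∃ b : Module.Basis ι ℤ (ι → ℤ), Set.extremePoints ℝ F = Set.range fun i => toReal (b i)

end Polytopes

section Posets

/-- `P̂`: the poset `P` with a new minimum `⊥` and a new maximum `⊤` adjoined. -/
abbrev Hat (P : Type*) : Type _ := WithBot (WithTop P)

variable {P : Type*}

open Classical in
/-- The unit coordinate vector of `ℝ^P` attached to an element of `P̂`:
it is `e_p` for `p ∈ P`, and it is `0` for `⊥` and for `⊤`. -/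
noncomputable def unitVec (x : Hat P) : P → ℝ :=
  fun p => if x = ((p : WithTop P) : Hat P) then 1 else 0

/-- `ρ` of the edge `{x, y}` with `x < y`. It is `e_x` if `y = ⊤` and `x ∈ P`, it is `-e_y` if
`x = ⊥` and `y ∈ P`, and it is `e_x - e_y` if `x, y ∈ P`. -/
noncomputable def rho (x y : Hat P) : P → ℝ := unitVec x - unitVec y

variable [PartialOrder P]

/-- The polytope `Q_P`: the convex hull of all `ρ(e)`, where `e` runs through the edges of the
Hasse diagram of `P̂`. -/
noncomputable def polytope (P : Type*) [PartialOrder P] : Set (P → ℝ) :=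
  convexHull ℝ {v | ∃ x y : Hat P, x ⋖ y ∧ v = rho x y}

/-- The distance of `y ≤ z` in `P̂`: the smallest `s` for which there is a saturated chain
`y = q 0 ⋖ q 1 ⋖ ⋯ ⋖ q s = z`. -/
noncomputable def chainDist (y z : Hat P) : ℕ :=
  sInf {s | ∃ q : ℕ → Hat P, q 0 = y ∧ q s = z ∧ ∀ i < s, q i ⋖ q (i + 1)}

/-- The Hasse diagram of `P̂`, as an undirected graph. -/
abbrev hatGraph (P : Type*) [PartialOrder P] : SimpleGraph (Hat P) := SimpleGraph.hasse (Hat P)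

open Classical in
/-- A path (or a cycle, viewed as a closed walk) is special if it has as many ascending steps as
descending ones. -/
def IsSpecial {u v : Hat P} (w : (hatGraph P).Walk u v) : Prop :=
  w.darts.countP (fun d => d.fst < d.snd) = w.darts.countP (fun d => d.snd < d.fst)

/-- `μ` is the function `μ_w` on the vertices of the special path or cycle `w`: it rises by `1`
along each ascending step, falls by `1` along each descending step, and has minimum `0` on the
vertices of `w`. (Its values off the vertices of `w` are irrelevant.) -/
def IsMu {u v : Hat P} (w : (hatGraph P).Walk u v) (μ : Hat P → ℕ) : Prop :=
  (∀ d ∈ w.darts, (d.fst < d.snd → μ d.snd = μ d.fst + 1) ∧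
    (d.snd < d.fst → μ d.fst = μ d.snd + 1)) ∧
  ∃ x ∈ w.support, μ x = 0

theorem hat_lt_or_gt (d : (hatGraph P).Dart) : d.fst < d.snd ∨ d.snd < d.fst :=
  (SimpleGraph.hasse_adj.1 d.adj).imp (fun h => h.lt) (fun h => h.lt)

open Classical in
/-- `+1` on ascending steps and `-1` on descending ones. -/
noncomputable def stepSign (d : (hatGraph P).Dart) : ℤ := if d.fst < d.snd then 1 else -1

open Classical in
theorem sum_stepSign (l : List (hatGraph P).Dart) :
    (l.map stepSign).sum =
      (l.countP (fun d => d.fst < d.snd) : ℤ) - (l.countP (fun d => d.snd < d.fst) : ℤ) := by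
  induction l with
  | nil => simp
  | cons d l ih =>
    rcases hat_lt_or_gt d with h | h
    · simp [stepSign, ih, h, h.not_gt]; ring
    · simp [stepSign, ih, h, h.not_gt]; ring

theorem telescope {u v : Hat P} (w : (hatGraph P).Walk u v) (f : Hat P → ℤ)
    (hf : ∀ d ∈ w.darts, f d.snd - f d.fst = stepSign d) :
    f v - f u = (w.darts.map stepSign).sum := by
  induction w with
  | nil => simp
  | cons h p ih =>
    have h1 := ih (fun d hd => hf d (by simp [hd]))
    have h2 := hf ⟨(_, _), h⟩ (by simp)
    simp only [SimpleGraph.Walk.darts_cons, List.map_cons, List.sum_cons]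
    simp only at h2
    linarith

theorem exists_potential {u v : Hat P} (w : (hatGraph P).Walk u v) (hw : w.IsPath) :
    ∃ f : Hat P → ℤ, ∀ d ∈ w.darts, f d.snd - f d.fst = stepSign d := by
  classical
  induction w with
  | nil => exact ⟨0, by simp⟩
  | @cons a b c h p ih =>
    rw [SimpleGraph.Walk.cons_isPath_iff] at hw
    obtain ⟨f, hf⟩ := ih hw.1
    refine ⟨Function.update f a (f b - stepSign ⟨(a, b), h⟩), fun d hd => ?_⟩
    simp only [SimpleGraph.Walk.darts_cons, List.mem_cons] at hd
    rcases hd with rfl | hd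
    · have : b ≠ a := h.ne'
      simp [Function.update_of_ne this]
    · have h1 : d.fst ≠ a := fun e => hw.2 (e ▸ p.dart_fst_mem_support_of_mem_darts hd)
      have h2 : d.snd ≠ a := fun e => hw.2 (e ▸ p.dart_snd_mem_support_of_mem_darts hd)
      rw [Function.update_of_ne h1, Function.update_of_ne h2]
      exact hf d hd

theorem exists_isMu_of_potential {u v : Hat P} (w : (hatGraph P).Walk u v) (f : Hat P → ℤ)
    (hf : ∀ d ∈ w.darts, f d.snd - f d.fst = stepSign d) : ∃ μ, IsMu w μ := by
  classical
  obtain ⟨x, hx, hmin⟩ := Finset.exists_min_image w.support.toFinset f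
    ⟨u, by simp⟩
  have hm : ∀ y ∈ w.support, f x ≤ f y := fun y hy => hmin y (by simpa using hy)
  refine ⟨fun y => (f y - f x).toNat, fun d hd => ?_, x, by simpa using hx, by simp⟩
  have h1 := hm _ (w.dart_fst_mem_support_of_mem_darts hd)
  have h2 := hm _ (w.dart_snd_mem_support_of_mem_darts hd)
  have h3 := hf d hd
  refine ⟨fun h => ?_, fun h => ?_⟩
  · simp only [stepSign, h, if_true] at h3
    lia
  · simp only [stepSign, h.not_gt, if_false] at h3
    lia

/-- A path has a function `μ`. -/
theorem exists_isMu_of_isPath {u v : Hat P} (w : (hatGraph P).Walk u v) (hw : w.IsPath) :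
    ∃ μ, IsMu w μ := by
  obtain ⟨f, hf⟩ := exists_potential w hw
  exact exists_isMu_of_potential w f hf

/-- A special cycle has a function `μ`. -/
theorem exists_isMu_of_isCycle {u : Hat P} (c : (hatGraph P).Walk u u) (hc : c.IsCycle)
    (hs : IsSpecial c) : ∃ μ, IsMu c μ := by
  classical
  cases c with
  | nil => exact absurd rfl hc.ne_nil
  | cons h p =>
    have hp := (SimpleGraph.Walk.cons_isCycle_iff _ _).1 hc
    obtain ⟨f, hf⟩ := exists_potential p hp.1
    refine exists_isMu_of_potential _ f fun d hd => ?_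
    simp only [SimpleGraph.Walk.darts_cons, List.mem_cons] at hd
    rcases hd with rfl | hd
    · have h1 := telescope p f hf
      have h2 := sum_stepSign (SimpleGraph.Walk.cons h p).darts
      rw [IsSpecial] at hs
      rw [hs, sub_self] at h2
      simp only [SimpleGraph.Walk.darts_cons, List.map_cons, List.sum_cons] at h2
      simp only
      linarith
    · exact hf d hd

/-- The function `μ` is unique on the vertices of the walk. -/
theorem IsMu.unique {u v : Hat P} {w : (hatGraph P).Walk u v} {μ ν : Hat P → ℕ}
    (hμ : IsMu w μ) (hν : IsMu w ν) : ∀ x ∈ w.support, μ x = ν x := by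
  have key : ∀ {a b : Hat P} (p : (hatGraph P).Walk a b),
      (∀ d ∈ p.darts, d ∈ w.darts) → ∀ x ∈ p.support, (μ x : ℤ) - ν x = μ a - ν a := by
    intro a b p
    induction p with
    | nil => intro _ x hx; simp at hx; rw [hx]
    | @cons a b c h p ih =>
      intro hd x hx
      have hd0 := hd ⟨(a, b), h⟩ (by simp)
      have hab : (μ b : ℤ) - ν b = μ a - ν a := by
        have h1 := hμ.1 _ hd0
        have h2 := hν.1 _ hd0
        rcases hat_lt_or_gt ⟨(a, b), h⟩ with hlt | hlt
        · have := h1.1 hlt; have := h2.1 hlt; simp only at *; lia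
        · have := h1.2 hlt; have := h2.2 hlt; simp only at *; lia
      rw [SimpleGraph.Walk.support_cons, List.mem_cons] at hx
      rcases hx with rfl | hx
      · rfl
      · rw [ih (fun d h' => hd d (by simp [h'])) x hx, hab]
  obtain ⟨y, hy, hy0⟩ := hμ.2
  obtain ⟨z, hz, hz0⟩ := hν.2
  intro x hx
  have h1 := key w (fun _ h => h) x hx
  have h2 := key w (fun _ h => h) y hy
  have h3 := key w (fun _ h => h) z hz
  lia

/-- A very special cycle: a special cycle that does not pass through both `⊥` and `⊤`. -/
def IsVerySpecialCycle {u : Hat P} (c : (hatGraph P).Walk u u) : Prop :=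
  c.IsCycle ∧ IsSpecial c ∧ ¬ (⊥ ∈ c.support ∧ ⊤ ∈ c.support)

/-- For all vertices `y < x` of `w`, `μ x - μ y ≤ dist(y, x)`. -/
def DistIneq {u v : Hat P} (w : (hatGraph P).Walk u v) (μ : Hat P → ℕ) : Prop :=
  ∀ x ∈ w.support, ∀ y ∈ w.support, y < x → (μ x : ℤ) - (μ y : ℤ) ≤ (chainDist y x : ℤ)

/-- For all vertices `x, y` of `w`, `μ x - μ y ≤ dist(⊥, x) + dist(y, ⊤)`. -/
def EndsIneq {u v : Hat P} (w : (hatGraph P).Walk u v) (μ : Hat P → ℕ) : Prop :=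
  ∀ x ∈ w.support, ∀ y ∈ w.support,
    (μ x : ℤ) - (μ y : ℤ) ≤ (chainDist ⊥ x : ℤ) + (chainDist y ⊤ : ℤ)

end Posets

end PosetFano

namespace PosetFano

/-! ### Saturated chains and the directed distance of `P̂`. -/

section Chains

variable {P : Type*} [PartialOrder P]

/-! The origin is interior to `Q_P`, so each nonempty proper face is cut out by `L = 1` for some
linear `L` that is at most `1` on all generators. Put `g x = -L (unitVec x)`. Then `L (rho x y) = g
y - g x`: such an `L` amounts, up to an additive constant in `g`, to a function `g` on `P̂` with `g
⊥ = g ⊤` that rises by at most `1` along each covering relation. The generators on the face come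
from the edges along which `g` rises by exactly `1`. All generators are vertices of `Q_P`, so `Q_P`
is simplicial iff every such tight set is linearly independent (`isQFactorialFano_polytope_iff`).

The vectors `rho x y` are signed incidence vectors of the Hasse diagram with `⊥` and `⊤` glued
together. A set of them is dependent iff its edges contain a cycle of the glued graph, that is, a
cycle of the diagram avoiding `⊥` or `⊤`, or a path from `⊥` to `⊤` (`exists_isCycle_or_isPath`,
`EdgesIn.not_linearIndependent`).

Along a tight walk of this kind `g` changes by `±1` at each step and returns to its initial value.
Hence the walk is special, `g` is `μ` up to a constant, and the inequalities of (iii) express that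
`g` is Lipschitz. Conversely, those inequalities let `μ` extend to a Lipschitz `g` on all of `P̂`
(`exists_lipschitz_extension`), hence to a face containing the walk. Smoothness comes for free,
because incidence vectors that form a real basis form a `ℤ`-basis (`exists_intBasis_of_span_tight`).
-/

theorem exists_saturated_chain [Finite P] {y z : Hat P} (h : y ≤ z) :
    ∃ (s : ℕ) (q : ℕ → Hat P), q 0 = y ∧ q s = z ∧ ∀ i < s, q i ⋖ q (i + 1) := by
  classical
  have := Fintype.ofFinite P
  let _ : LocallyFiniteOrder (Hat P) := Fintype.toLocallyFiniteOrder
  rw [le_iff_reflTransGen_covBy] at h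
  induction h with
  | refl => exact ⟨0, fun _ => y, rfl, rfl, by simp⟩
  | @tail b c _ hbc ih =>
    obtain ⟨s, q, h0, hs, hq⟩ := ih
    refine ⟨s + 1, fun i => if i ≤ s then q i else c, by simp [h0], by simp, fun i hi => ?_⟩
    rcases Nat.lt_succ_iff_lt_or_eq.1 hi with hi | rfl
    · simpa [hi.le, Nat.succ_le_of_lt hi] using hq i hi
    · simpa [hs] using hbc

/-- For `y ≤ z` the infimum runs over a nonempty set and is attained; it is not the default value
`0` of `sInf ∅`. -/
theorem exists_chain_length_chainDist [Finite P] {y z : Hat P} (h : y ≤ z) :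
    ∃ q : ℕ → Hat P, q 0 = y ∧ q (chainDist y z) = z ∧
      ∀ i < chainDist y z, q i ⋖ q (i + 1) := by
  obtain ⟨s, hs⟩ := exists_saturated_chain h
  exact Nat.sInf_mem (s := {s | ∃ q : ℕ → Hat P, q 0 = y ∧ q s = z ∧ ∀ i < s, q i ⋖ q (i + 1)})
    ⟨s, hs⟩

theorem chainDist_self (y : Hat P) : chainDist y y = 0 :=
  Nat.sInf_eq_zero.2 (Or.inl ⟨fun _ => y, rfl, rfl, by simp⟩)

theorem chainDist_le_add_one [Finite P] {y z z' : Hat P} (h : y ≤ z) (hz : z ⋖ z') :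
    chainDist y z' ≤ chainDist y z + 1 := by
  obtain ⟨q, h0, hs, hq⟩ := exists_chain_length_chainDist h
  refine Nat.sInf_le ⟨fun i => if i ≤ chainDist y z then q i else z', by simp [h0], by simp,
    fun i hi => ?_⟩
  rcases Nat.lt_succ_iff_lt_or_eq.1 hi with hi | rfl
  · simpa [hi.le, Nat.succ_le_of_lt hi] using hq i hi
  · simpa [hs] using hz

/-- A function on `P̂` that rises by at most `1` along each covering relation is bounded by the
distance. -/
theorem sub_le_chainDist [Finite P] {f : Hat P → ℝ} (hf : ∀ x y, x ⋖ y → f y - f x ≤ 1)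
    {y z : Hat P} (h : y ≤ z) : f z - f y ≤ chainDist y z := by
  obtain ⟨q, h0, hs, hq⟩ := exists_chain_length_chainDist h
  have key : ∀ i ≤ chainDist y z, f (q i) - f (q 0) ≤ i := by
    intro i
    induction i with
    | zero => simp
    | succ i ih =>
      intro hi
      have h1 := ih (by lia)
      have h2 := hf _ _ (hq i (by lia))
      push_cast
      linarith
  have := key _ le_rfl
  rwa [h0, hs] at this

/-- Lipschitz extension with respect to the directed distance of `P̂`. -/
theorem exists_lipschitz_extension [Finite P] (S : Set (Hat P)) (hS : ⊥ ∈ S) (ν : Hat P → ℤ)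
    (hν : ∀ x ∈ S, ∀ y ∈ S, y < x → ν x - ν y ≤ chainDist y x) :
    ∃ g : Hat P → ℤ, (∀ x ∈ S, g x = ν x) ∧ ∀ x y, x ⋖ y → g y - g x ≤ 1 := by
  -- McShane's formula: `g z` is the minimum of `ν c + dist(c, z)` over `c ∈ S` below `z`. Since `⊥
  -- ∈ S`, there is always a candidate.
  have hex : ∀ z : Hat P, ∃ c ∈ {c | c ∈ S ∧ c ≤ z}, ∀ c' ∈ {c | c ∈ S ∧ c ≤ z},
      ν c + chainDist c z ≤ ν c' + chainDist c' z := fun z =>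
    Set.exists_min_image _ (fun c => ν c + chainDist c z) (Set.toFinite _) ⟨⊥, hS, bot_le⟩
  choose c hc hmin using hex
  refine ⟨fun z => ν (c z) + chainDist (c z) z, fun x hx => ?_, fun x y hxy => ?_⟩
  · have h1 := hmin x x ⟨hx, le_rfl⟩
    dsimp only
    rw [chainDist_self] at h1
    rcases (hc x).2.eq_or_lt with h | h
    · rw [h, chainDist_self]; simp
    · have := hν x hx _ (hc x).1 h
      push_cast at h1
      linarith
  -- The minimiser for `x` also competes for `y`, at a cost of at most one more step.
  · have h1 := hmin y (c x) ⟨(hc x).1, (hc x).2.trans hxy.le⟩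
    have h2 := chainDist_le_add_one (hc x).2 hxy
    dsimp only
    lia

end Chains

end PosetFano

namespace PosetFano

/-! ### Faces and extreme points of convex hulls. -/

section Hulls

variable {E : Type*} [AddCommGroup E] [Module ℝ E]

/-- The face of a convex hull cut out by a functional is spanned by the generators on it. -/
theorem mem_convexHull_of_eq_bound (S : Set E) (L : E →ₗ[ℝ] ℝ) (c : ℝ) (hS : ∀ v ∈ S, L v ≤ c)
    {x : E} (hx : x ∈ convexHull ℝ S) : L x ≤ c ∧ (L x = c → x ∈ convexHull ℝ {v ∈ S | L v = c}) := by
  have hsub : S ⊆ {x | L x ≤ c ∧ (L x = c → x ∈ convexHull ℝ {v ∈ S | L v = c})} :=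
    fun v hv => ⟨hS v hv, fun h => subset_convexHull ℝ _ ⟨hv, h⟩⟩
  refine convexHull_min hsub (convex_iff_forall_pos.2 ?_) hx
  rintro x ⟨hx1, hx2⟩ y ⟨hy1, hy2⟩ a b ha hb hab
  have h1 : L (a • x + b • y) = a * L x + b * L y := by simp
  have h2 : a * L x ≤ a * c := mul_le_mul_of_nonneg_left hx1 ha.le
  have h3 : b * L y ≤ b * c := mul_le_mul_of_nonneg_left hy1 hb.le
  have h4 : a * c + b * c = c := by rw [← add_mul, hab, one_mul]
  refine ⟨by linarith, fun h => ?_⟩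
  have h5 : L x = c := mul_left_cancel₀ ha.ne' (by linarith)
  have h6 : L y = c := mul_left_cancel₀ hb.ne' (by linarith)
  exact convex_convexHull ℝ _ (hx2 h5) (hy2 h6) ha.le hb.le hab

theorem mem_extremePoints_convexHull (S : Set E) (L : E →ₗ[ℝ] ℝ) {v : E} (hv : v ∈ S)
    (hS : ∀ w ∈ S, w ≠ v → L w < L v) : v ∈ (convexHull ℝ S).extremePoints ℝ := by
  have hle : ∀ w ∈ S, L w ≤ L v := fun w hw => by
    by_cases h : w = v
    · rw [h]
    · exact (hS w hw h).le
  have hsing : {w ∈ S | L w = L v} = {v} := by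
    ext w
    refine ⟨fun h => ?_, fun h => ?_⟩
    · by_contra hne
      exact (hS w h.1 hne).ne h.2
    · rw [Set.mem_singleton_iff.1 h]; exact ⟨hv, rfl⟩
  have huniq : ∀ x ∈ convexHull ℝ S, L x ≤ L v ∧ (L x = L v → x = v) := fun x hx => by
    have := mem_convexHull_of_eq_bound S L (L v) hle hx
    rw [hsing, convexHull_singleton] at this
    exact this
  refine mem_extremePoints.2 ⟨subset_convexHull ℝ _ hv, fun x hx y hy hxy => ?_⟩
  obtain ⟨a, b, ha, hb, hab, rfl⟩ := hxy
  obtain ⟨hx1, hx2⟩ := huniq x hx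
  obtain ⟨hy1, hy2⟩ := huniq y hy
  set v := a • x + b • y with hvdef
  have h1 : L v = a * L x + b * L y := by simp [hvdef]
  have h2 : a * L x ≤ a * L v := mul_le_mul_of_nonneg_left hx1 ha.le
  have h3 : b * L y ≤ b * L v := mul_le_mul_of_nonneg_left hy1 hb.le
  have h4 : a * L v + b * L v = L v := by rw [← add_mul, hab, one_mul]
  exact ⟨hx2 (mul_left_cancel₀ ha.ne' (by linarith)), hy2 (mul_left_cancel₀ hb.ne' (by linarith))⟩

end Hulls

/-! ### The generators `ρ(e)` and their extremality. -/

section Generators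

variable {P : Type*}

@[simp] theorem unitVec_bot : unitVec (⊥ : Hat P) = 0 := by
  ext p; simp [unitVec]

@[simp] theorem unitVec_top : unitVec (⊤ : Hat P) = 0 := by
  ext p
  have : (⊤ : Hat P) ≠ ((p : WithTop P) : Hat P) := by
    rw [← WithBot.coe_top, Ne, WithBot.coe_inj]; exact WithTop.top_ne_coe
  simp [unitVec, this]

open Classical in
theorem unitVec_coe (p : P) : unitVec ((p : WithTop P) : Hat P) = Pi.single p 1 := by
  ext q
  by_cases h : q = p
  · simp [unitVec, h]
  · simp [unitVec, h, Ne.symm h]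

theorem hat_cases (x : Hat P) : x = ⊥ ∨ x = ⊤ ∨ ∃ p : P, x = ((p : WithTop P) : Hat P) := by
  match x with
  | none => exact Or.inl rfl
  | some none => exact Or.inr (Or.inl rfl)
  | some (some p) => exact Or.inr (Or.inr ⟨p, rfl⟩)

theorem unitVec_apply_mem (x : Hat P) (p : P) : unitVec x p = 0 ∨ unitVec x p = 1 := by
  unfold unitVec; split_ifs <;> simp

theorem abs_rho_apply_le (x y : Hat P) (p : P) : |rho x y p| ≤ 1 := by
  simp only [rho, Pi.sub_apply]
  rcases unitVec_apply_mem x p with h | h <;> rcases unitVec_apply_mem y p with h' | h' <;>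
    simp [h, h']

variable [PartialOrder P]

/-- The vectors `ρ(e)` of the edges of the Hasse diagram of `P̂`. -/
def gens (P : Type*) [PartialOrder P] : Set (P → ℝ) := {v | ∃ x y : Hat P, x ⋖ y ∧ v = rho x y}

theorem polytope_eq : polytope P = convexHull ℝ (gens P) := rfl

theorem gens_finite [Finite P] : (gens P).Finite := by
  have : gens P ⊆ Set.range fun e : Hat P × Hat P => rho e.1 e.2 := by
    rintro v ⟨x, y, _, rfl⟩
    exact ⟨(x, y), rfl⟩
  exact (Set.finite_range _).subset this

theorem rho_apply_eq_one_iff {x y : Hat P} (h : x ⋖ y) (p : P) :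
    rho x y p = 1 ↔ x = ((p : WithTop P) : Hat P) := by
  simp only [rho, Pi.sub_apply, unitVec]
  by_cases h1 : x = ((p : WithTop P) : Hat P)
  · have : y ≠ ((p : WithTop P) : Hat P) := fun h2 => h.lt.ne (h1.trans h2.symm)
    simp [h1, this]
  · simp only [h1, if_false, iff_false]
    split_ifs <;> norm_num

theorem rho_apply_eq_neg_one_iff {x y : Hat P} (h : x ⋖ y) (p : P) :
    rho x y p = -1 ↔ y = ((p : WithTop P) : Hat P) := by
  simp only [rho, Pi.sub_apply, unitVec]
  by_cases h1 : y = ((p : WithTop P) : Hat P)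
  · have : x ≠ ((p : WithTop P) : Hat P) := fun h2 => h.lt.ne (h2.trans h1.symm)
    simp [h1, this]
  · simp only [h1, if_false, iff_false]
    split_ifs <;> norm_num

theorem abs_apply_le_of_mem_polytope {v : P → ℝ} (hv : v ∈ polytope P) (p : P) : |v p| ≤ 1 := by
  have hconv : Convex ℝ {v : P → ℝ | |v p| ≤ 1} := by
    have : {v : P → ℝ | |v p| ≤ 1} = (LinearMap.proj (R := ℝ) p : (P → ℝ) →ₗ[ℝ] ℝ) ⁻¹'
        Set.Icc (-1) 1 := by
      ext v; simp [abs_le]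
    rw [this]
    exact (convex_Icc _ _).linear_preimage _
  refine convexHull_min ?_ hconv hv
  rintro v ⟨x, y, _, rfl⟩
  exact abs_rho_apply_le x y p

/-- The vectors `ρ(e)` are vertices of `Q_P`. -/
theorem gens_subset_extremePoints [Finite P] : gens P ⊆ (polytope P).extremePoints ℝ := by
  rintro v ⟨x, y, hxy, rfl⟩
  have hle : ∀ (a b : Hat P) (p : P), rho a b p ≤ 1 ∧ -1 ≤ rho a b p := fun a b p =>
    ⟨(abs_le.1 (abs_rho_apply_le a b p)).2, (abs_le.1 (abs_rho_apply_le a b p)).1⟩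
  suffices ∃ L : (P → ℝ) →ₗ[ℝ] ℝ, ∀ w ∈ gens P, w ≠ rho x y → L w < L (rho x y) by
    obtain ⟨L, hL⟩ := this
    exact mem_extremePoints_convexHull _ L ⟨x, y, hxy, rfl⟩ hL
  -- Coordinates of generators lie in `[-1, 1]`, and the values `1` and `-1` identify the lower and
  -- upper end of the edge. The functional therefore tests the ends of the edge that lie in `P`.
  rcases hat_cases x with hx | hx | ⟨p, hp⟩
  · rcases hat_cases y with hy | hy | ⟨q, hq⟩
    · subst hx hy; exact absurd hxy.lt (lt_irrefl _)
    -- The covering `⊥ ⋖ ⊤` forces `P` to be empty, so there is no second generator to separate.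
    · refine ⟨0, ?_⟩
      rintro w ⟨a, b, hab, rfl⟩ hne
      refine absurd ?_ hne
      have ext : ∀ c : Hat P, unitVec c = 0 := fun c => by
        rcases hat_cases c with rfl | rfl | ⟨r, rfl⟩
        · simp
        · simp
        · subst hx hy
          exact absurd (WithBot.coe_lt_coe.2 (WithTop.coe_lt_top r))
            (hxy.2 (WithBot.bot_lt_coe _))
      simp [rho, ext]
    · refine ⟨-(LinearMap.proj q : (P → ℝ) →ₗ[ℝ] ℝ), ?_⟩
      rintro w ⟨a, b, hab, rfl⟩ hne
      have h1 := (rho_apply_eq_neg_one_iff hxy q).2 hq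
      simp only [LinearMap.neg_apply, LinearMap.proj_apply, h1]
      have h2 : rho a b q ≠ -1 := fun h => by
        have hb := (rho_apply_eq_neg_one_iff hab q).1 h
        refine hne ?_
        subst hb hx
        have : a = ⊥ := by
          by_contra h3
          rw [← hq] at hab
          exact hxy.2 (bot_lt_iff_ne_bot.2 h3) hab.lt
        rw [this, hq]
      have h3 := (hle a b q).2
      have := lt_of_le_of_ne h3 h2.symm
      linarith
  · subst hx; exact absurd hxy.lt not_top_lt
  · rcases hat_cases y with hy | hy | ⟨q, hq⟩
    · subst hy; exact absurd hxy.lt not_lt_bot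
    · refine ⟨LinearMap.proj p, ?_⟩
      rintro w ⟨a, b, hab, rfl⟩ hne
      have h1 := (rho_apply_eq_one_iff hxy p).2 hp
      simp only [LinearMap.proj_apply, h1]
      have h2 : rho a b p ≠ 1 := fun h => by
        have hb := (rho_apply_eq_one_iff hab p).1 h
        refine hne ?_
        subst hb hy
        have : b = ⊤ := by
          by_contra h3
          rw [← hp] at hab
          exact hxy.2 hab.lt (lt_top_iff_ne_top.2 h3)
        rw [this, hp]
      exact lt_of_le_of_ne (hle a b p).1 h2
    · refine ⟨(LinearMap.proj p : (P → ℝ) →ₗ[ℝ] ℝ) - LinearMap.proj q, ?_⟩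
      rintro w ⟨a, b, hab, rfl⟩ hne
      have h1 := (rho_apply_eq_one_iff hxy p).2 hp
      have h2 := (rho_apply_eq_neg_one_iff hxy q).2 hq
      simp only [LinearMap.sub_apply, LinearMap.proj_apply, h1, h2]
      by_contra hcon
      have h3 := (hle a b p).1
      have h4 := (hle a b q).2
      have ha := (rho_apply_eq_one_iff hab p).1 (by linarith)
      have hb := (rho_apply_eq_neg_one_iff hab q).1 (by linarith)
      exact hne (by rw [ha, hb, hp, hq])

end Generators

end PosetFano

namespace PosetFano

/-! ### The origin as unique interior lattice point. -/

section Origin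

open scoped Pointwise

variable {P : Type*} [PartialOrder P]

theorem convex_polytope : Convex ℝ (polytope P) := convex_convexHull ℝ _

/-- The vectors that have a positive multiple in a convex set are closed under addition. -/
theorem exists_pos_smul_mem_add {E : Type*} [AddCommGroup E] [Module ℝ E] {Q : Set E}
    (hQ : Convex ℝ Q) {u v : E} (hu : ∃ ε : ℝ, 0 < ε ∧ ε • u ∈ Q) (hv : ∃ ε : ℝ, 0 < ε ∧ ε • v ∈ Q) :
    ∃ ε : ℝ, 0 < ε ∧ ε • (u + v) ∈ Q := by
  obtain ⟨a, ha, hu⟩ := hu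
  obtain ⟨b, hb, hv⟩ := hv
  refine ⟨a * b / (a + b), by positivity, ?_⟩
  have := hQ hu hv (a := b / (a + b)) (b := a / (a + b)) (by positivity) (by positivity)
    (by field_simp; ring)
  convert this using 1
  rw [smul_smul, smul_smul, smul_add]
  congr 2 <;> ring

/-- Along a saturated chain the vectors of the edges telescope to `unitVec y - unitVec z`. For `⊥ <
⊤` this gives the origin, for `⊥ < p` a multiple of `-e_p`, for `p < ⊤` a multiple of `e_p`. -/
theorem exists_pos_smul_sub_mem [Finite P] {y z : Hat P} (h : y < z) :
    ∃ ε : ℝ, 0 < ε ∧ ε • (unitVec y - unitVec z) ∈ polytope P := by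
  have hcov : ∀ {a b : Hat P}, a ⋖ b →
      ∃ ε : ℝ, 0 < ε ∧ ε • (unitVec a - unitVec b) ∈ polytope P := fun {a b} hab =>
    ⟨1, one_pos, by rw [one_smul]; exact subset_convexHull ℝ _ ⟨a, b, hab, rfl⟩⟩
  obtain ⟨s, q, h0, hs, hq⟩ := exists_saturated_chain h.le
  have key : ∀ i < s, ∃ ε : ℝ, 0 < ε ∧ ε • (unitVec (q 0) - unitVec (q (i + 1))) ∈ polytope P := by
    intro i
    induction i with
    | zero => exact fun hi => hcov (hq 0 hi)
    | succ i ih =>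
      intro hi
      have := exists_pos_smul_mem_add convex_polytope (ih (by lia)) (hcov (hq (i + 1) hi))
      rwa [sub_add_sub_cancel] at this
  cases s with
  | zero => exact absurd (h0.symm.trans hs) h.ne
  | succ s =>
    have := key s (by lia)
    rwa [h0, hs] at this

theorem zero_mem_polytope [Finite P] : (0 : P → ℝ) ∈ polytope P := by
  obtain ⟨ε, _, h⟩ := exists_pos_smul_sub_mem (P := P) (y := ⊥) (z := ⊤) bot_lt_top
  simpa using h

/-- `Q_P` is absorbing. -/
theorem exists_pos_smul_mem_polytope [Finite P] (v : P → ℝ) :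
    ∃ ε : ℝ, 0 < ε ∧ ε • v ∈ polytope P := by
  classical
  have := Fintype.ofFinite P
  rw [pi_eq_sum_univ' v]
  refine Finset.sum_induction _ (fun w => ∃ ε : ℝ, 0 < ε ∧ ε • w ∈ polytope P)
    (fun _ _ => exists_pos_smul_mem_add convex_polytope)
    ⟨1, one_pos, by simpa using zero_mem_polytope⟩ fun p _ => ?_
  rw [← unitVec_coe]
  rcases lt_trichotomy (v p) 0 with h | h | h
  · obtain ⟨ε, hε, hm⟩ := exists_pos_smul_sub_mem (P := P) (WithBot.bot_lt_coe (p : WithTop P))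
    refine ⟨ε / (-v p), div_pos hε (by linarith), ?_⟩
    rw [smul_smul, div_mul_eq_mul_div, mul_div_assoc, div_neg, div_self h.ne]
    simpa using hm
  · exact ⟨1, one_pos, by simpa [h] using zero_mem_polytope⟩
  · obtain ⟨ε, hε, hm⟩ := exists_pos_smul_sub_mem (P := P)
      (WithBot.coe_lt_coe.2 (WithTop.coe_lt_top p))
    refine ⟨ε / v p, div_pos hε h, ?_⟩
    rw [smul_smul, div_mul_cancel₀ _ h.ne']
    rw [WithBot.coe_top, unitVec_top, sub_zero] at hm
    exact hm

theorem zero_mem_interior_polytope [Finite P] : (0 : P → ℝ) ∈ interior (polytope P) := by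
  have := Fintype.ofFinite P
  -- Some simplex has the origin in its interior; as `Q_P` is absorbing, a small enough multiple of
  -- it fits into `Q_P`.
  obtain ⟨b, hb, -⟩ := exists_mem_interior_convexHull_affineBasis
    (Filter.univ_mem : (Set.univ : Set (P → ℝ)) ∈ nhds 0)
  have hε : ∃ ε : ℝ, 0 < ε ∧ ∀ i, ε • b i ∈ polytope P := by
    choose e he hm using fun i => exists_pos_smul_mem_polytope (b i)
    have hne : Nonempty (Fin (Module.finrank ℝ (P → ℝ) + 1)) := inferInstance
    obtain ⟨i₀, hi₀⟩ := Finite.exists_min e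
    refine ⟨e i₀, he i₀, fun i => ?_⟩
    have := convex_polytope.smul_mem_of_zero_mem zero_mem_polytope (hm i) (t := e i₀ / e i)
      ⟨(div_pos (he _) (he _)).le, (div_le_one (he _)).2 (hi₀ i)⟩
    rwa [smul_smul, div_mul_cancel₀ _ (he i).ne'] at this
  obtain ⟨ε, hε, hm⟩ := hε
  have hsub : ε • convexHull ℝ (Set.range b) ⊆ polytope P := by
    rw [← convexHull_smul]
    refine convexHull_min ?_ convex_polytope
    rintro _ ⟨_, ⟨i, rfl⟩, rfl⟩
    exact hm i
  refine interior_mono hsub ?_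
  rw [interior_smul₀ hε.ne']
  exact ⟨0, hb, by simp⟩

open Classical in
/-- The integer version of `unitVec`. -/
noncomputable def intUnitVec {P : Type*} (x : Hat P) : P → ℤ :=
  fun p => if x = ((p : WithTop P) : Hat P) then 1 else 0

theorem toReal_intUnitVec_sub {P : Type*} (x y : Hat P) :
    toReal (intUnitVec x - intUnitVec y) = rho x y := by
  ext p
  simp only [toReal, intUnitVec, rho, unitVec, Pi.sub_apply]
  push_cast
  rfl

theorem isIntegralPolytope_polytope [Finite P] : IsIntegralPolytope (polytope P) := by
  refine ⟨{v | ∃ x y : Hat P, x ⋖ y ∧ v = intUnitVec x - intUnitVec y}, ?_, ?_⟩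
  · have : {v | ∃ x y : Hat P, x ⋖ y ∧ v = intUnitVec x - intUnitVec y} ⊆
        Set.range fun e : Hat P × Hat P => intUnitVec e.1 - intUnitVec e.2 := by
      rintro v ⟨x, y, _, rfl⟩
      exact ⟨(x, y), rfl⟩
    exact (Set.finite_range _).subset this
  · rw [polytope_eq]
    congr 1
    ext v
    constructor
    · rintro ⟨x, y, h, rfl⟩
      exact ⟨_, ⟨x, y, h, rfl⟩, toReal_intUnitVec_sub x y⟩
    · rintro ⟨_, ⟨x, y, h, rfl⟩, rfl⟩
      exact ⟨x, y, h, toReal_intUnitVec_sub x y⟩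

theorem isFano_polytope [Finite P] : IsFano (polytope P) := by
  have := Fintype.ofFinite P
  refine ⟨isIntegralPolytope_polytope, fun v => ⟨fun hv => ?_, ?_⟩⟩
  -- An interior point `v` can be stretched to `t • v ∈ Q_P` with `t > 1`. Coordinates on `Q_P` are
  -- at most `1` in absolute value, so those of `v` are integers smaller than `1` in absolute value.
  · have hcont : Filter.Tendsto (fun t : ℝ => t • toReal v) (nhdsWithin 1 (Set.Ioi 1))
        (nhds ((1 : ℝ) • toReal v)) :=
      ((continuous_id.smul continuous_const).tendsto _).mono_left nhdsWithin_le_nhds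
    rw [one_smul] at hcont
    obtain ⟨t, ht1, ht⟩ := ((hcont.eventually (mem_interior_iff_mem_nhds.1 hv)).and
      self_mem_nhdsWithin).exists
    ext p
    have h := abs_apply_le_of_mem_polytope ht1 p
    have ht : (1 : ℝ) < t := ht
    simp only [Pi.smul_apply, smul_eq_mul, toReal, abs_mul, abs_of_pos (one_pos.trans ht)] at h
    by_contra hne
    have h1 : (1 : ℝ) ≤ |(v p : ℝ)| := by exact_mod_cast Int.one_le_abs hne
    nlinarith
  · rintro rfl
    have : toReal (0 : P → ℤ) = 0 := by ext; simp [toReal]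
    rw [this]
    exact zero_mem_interior_polytope

end Origin

/-! ### Faces, facets and linear independence. -/

section Faces

variable {P : Type*} [PartialOrder P]

/-- `L ≤ 1` is a valid inequality for `Q_P`. -/
def IsSupporting (L : (P → ℝ) →ₗ[ℝ] ℝ) : Prop := ∀ v ∈ gens P, L v ≤ 1

/-- The generators of `Q_P` on the hyperplane `L = 1`. -/
def tight (L : (P → ℝ) →ₗ[ℝ] ℝ) : Set (P → ℝ) := {v ∈ gens P | L v = 1}

theorem apply_eq_of_mem_convexHull {E : Type*} [AddCommGroup E] [Module ℝ E] (L : E →ₗ[ℝ] ℝ)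
    {S : Set E} {c : ℝ} (hS : ∀ v ∈ S, L v = c) {x : E} (hx : x ∈ convexHull ℝ S) : L x = c :=
  convexHull_min (s := S) (t := {x | L x = c}) hS
    (convex_hyperplane L.isLinear c) hx

theorem IsSupporting.le_one {L : (P → ℝ) →ₗ[ℝ] ℝ} (hL : IsSupporting L) {x : P → ℝ}
    (hx : x ∈ polytope P) : L x ≤ 1 := (mem_convexHull_of_eq_bound _ L 1 hL hx).1

theorem convexHull_tight_subset (L : (P → ℝ) →ₗ[ℝ] ℝ) : convexHull ℝ (tight L) ⊆ polytope P :=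
  convexHull_mono fun _ h => h.1

theorem convexHull_tight_ne [Finite P] (L : (P → ℝ) →ₗ[ℝ] ℝ) :
    convexHull ℝ (tight L) ≠ polytope P := fun h => by
  have h0 : (0 : P → ℝ) ∈ convexHull ℝ (tight L) := h ▸ zero_mem_polytope
  have := apply_eq_of_mem_convexHull L (c := 1) (fun v hv => hv.2) h0
  simp at this

theorem IsSupporting.isExposed [Finite P] {L : (P → ℝ) →ₗ[ℝ] ℝ} (hL : IsSupporting L) :
    IsExposed ℝ (polytope P) (convexHull ℝ (tight L)) := by
  intro hne
  obtain ⟨v, hv⟩ := convexHull_nonempty_iff.1 hne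
  refine ⟨LinearMap.toContinuousLinearMap L, Set.Subset.antisymm (fun x hx => ?_) fun x hx => ?_⟩
  · refine ⟨convexHull_tight_subset L hx, fun y hy => ?_⟩
    rw [LinearMap.coe_toContinuousLinearMap', apply_eq_of_mem_convexHull L (fun v hv => hv.2) hx]
    exact hL.le_one hy
  · have h1 := hx.2 v (subset_convexHull ℝ _ hv.1)
    rw [LinearMap.coe_toContinuousLinearMap', hv.2] at h1
    exact (mem_convexHull_of_eq_bound _ L 1 hL hx.1).2 (le_antisymm (hL.le_one hx.1) h1)

/-- The maximum on `Q_P` of the exposing functional is nonnegative because the origin belongs to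
`Q_P`. If it is `0`, the functional vanishes, `Q_P` being absorbing, and the face is all of `Q_P`;
otherwise it can be scaled to `1`. -/
theorem exists_isSupporting_of_isExposed [Finite P] {F : Set (P → ℝ)}
    (hF : IsExposed ℝ (polytope P) F) (hne : F.Nonempty) (hFQ : F ≠ polytope P) :
    ∃ L : (P → ℝ) →ₗ[ℝ] ℝ, IsSupporting L ∧ F = convexHull ℝ (tight L) := by
  obtain ⟨l, rfl⟩ := hF hne
  obtain ⟨x₀, hx₀, hmax⟩ := hne
  have hM : 0 ≤ l x₀ := by simpa using hmax 0 zero_mem_polytope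
  rcases hM.eq_or_lt with hM | hM
  · have hle : ∀ v, l v ≤ 0 := fun v => by
      obtain ⟨ε, hε, hv⟩ := exists_pos_smul_mem_polytope v
      have := hmax _ hv
      rw [map_smul, ← hM, smul_eq_mul] at this
      exact nonpos_of_mul_nonpos_right this hε
    have hl : ∀ v, l v = 0 := fun v => le_antisymm (hle v) (by simpa using hle (-v))
    exact absurd (by ext x; simp [hl]) hFQ
  · have hsup : IsSupporting ((l x₀)⁻¹ • (l : (P → ℝ) →ₗ[ℝ] ℝ)) := fun v hv => by
      have := hmax v (subset_convexHull ℝ _ hv)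
      simp only [LinearMap.smul_apply, ContinuousLinearMap.coe_coe, smul_eq_mul]
      rwa [inv_mul_le_iff₀ hM, mul_one]
    refine ⟨_, hsup, Set.Subset.antisymm (fun x hx => ?_) fun x hx => ?_⟩
    · refine (mem_convexHull_of_eq_bound _ _ 1 hsup hx.1).2 ?_
      have h1 : l x = l x₀ := le_antisymm (hmax x hx.1) (hx.2 x₀ hx₀)
      simp [h1, hM.ne']
    · have h1 := apply_eq_of_mem_convexHull _ (c := 1) (fun v hv => hv.2) hx
      simp only [LinearMap.smul_apply, ContinuousLinearMap.coe_coe, smul_eq_mul] at h1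
      rw [inv_mul_eq_iff_eq_mul₀ hM.ne', mul_one] at h1
      exact ⟨convexHull_tight_subset _ hx, fun y hy => h1 ▸ hmax y hy⟩

theorem extremePoints_convexHull_tight [Finite P] (L : (P → ℝ) →ₗ[ℝ] ℝ) :
    (convexHull ℝ (tight L)).extremePoints ℝ = tight L :=
  Set.Subset.antisymm extremePoints_convexHull_subset fun _ hv =>
    inter_extremePoints_subset_extremePoints_of_subset (convexHull_tight_subset L)
      ⟨subset_convexHull ℝ _ hv, gens_subset_extremePoints hv.1⟩

/-- Applying `L` to a linear relation shows that its coefficients sum to `0`, so the relation is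
affine. -/
theorem linearIndependent_of_affineIndependent {E : Type*} [AddCommGroup E] [Module ℝ E]
    (L : E →ₗ[ℝ] ℝ) {T : Set E} (hL : ∀ v ∈ T, L v = 1)
    (hT : AffineIndependent ℝ ((↑) : T → E)) : LinearIndependent ℝ ((↑) : T → E) := by
  rw [linearIndependent_iff']
  intro s g hg
  refine affineIndependent_iff.1 hT s g ?_ hg
  have := congrArg L hg
  simpa [map_sum, fun v : T => hL v v.2] using this

/-- `Q_P` is simplicial iff the generators on each proper face are linearly independent. -/
theorem isQFactorialFano_polytope_iff [Finite P] :
    IsQFactorialFano (polytope P) ↔ ∀ L : (P → ℝ) →ₗ[ℝ] ℝ, IsSupporting L →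
      LinearIndependent ℝ ((↑) : tight L → (P → ℝ)) := by
  refine ⟨fun h L hL => ?_, fun h => ⟨isFano_polytope, fun F hF hFQ => ?_⟩⟩
  · obtain ⟨s, -, hs, hLs⟩ := h.2 _ hL.isExposed (convexHull_tight_ne L)
    have hsub : tight L ⊆ s := by
      rw [← extremePoints_convexHull_tight L, hLs]
      exact extremePoints_convexHull_subset
    exact linearIndependent_of_affineIndependent L (fun v hv => hv.2) (hs.mono hsub)
  · rcases F.eq_empty_or_nonempty with rfl | hne
    · exact ⟨∅, Set.finite_empty, affineIndependent_of_subsingleton ℝ _, by simp⟩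
    · obtain ⟨L, hL, rfl⟩ := exists_isSupporting_of_isExposed hF hne hFQ
      exact ⟨tight L, gens_finite.subset fun _ h => h.1, (h L hL).affineIndependent ℝ, rfl⟩

/-- Every proper face of `Q_P` lies in a facet. -/
theorem IsSupporting.exists_span_eq_top [Finite P] {L : (P → ℝ) →ₗ[ℝ] ℝ} (hL : IsSupporting L) :
    ∃ L' : (P → ℝ) →ₗ[ℝ] ℝ, IsSupporting L' ∧ tight L ⊆ tight L' ∧
      Submodule.span ℝ (tight L') = ⊤ := by
  have hfin : {T : Set (P → ℝ) | ∃ L' : (P → ℝ) →ₗ[ℝ] ℝ,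
      IsSupporting L' ∧ tight L ⊆ tight L' ∧ T = tight L'}.Finite := by
    refine (gens_finite (P := P)).finite_subsets.subset ?_
    rintro _ ⟨L', _, _, rfl⟩
    exact fun v hv => hv.1
  obtain ⟨_, hmax⟩ := hfin.exists_maximal ⟨_, L, hL, subset_rfl, rfl⟩
  obtain ⟨L', hL', hsub, rfl⟩ := hmax.prop
  refine ⟨L', hL', hsub, ?_⟩
  by_contra hspan
  -- If a maximal tight set does not span, tilting `L'` by a functional `k` that vanishes on it
  -- keeps it tight.
  obtain ⟨k, hk0, hk⟩ := Submodule.exists_le_ker_of_lt_top _ (lt_top_iff_ne_top.2 hspan)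
  have hkt : ∀ v ∈ tight L', k v = 0 := fun v hv => hk (Submodule.subset_span hv)
  obtain ⟨u, hu⟩ : ∃ u, 0 < k u := by
    by_contra! hcon
    exact hk0 (LinearMap.ext fun v => le_antisymm (hcon v) (by simpa using hcon (-v)))
  have hpos : {v ∈ gens P | 0 < k v}.Nonempty := by
    by_contra hemp
    have hle : ∀ v ∈ gens P, k v ≤ 0 := fun v hv => by
      by_contra hcon
      exact hemp ⟨v, hv, not_le.1 hcon⟩
    obtain ⟨ε, hε, hεu⟩ := exists_pos_smul_mem_polytope u
    have := (mem_convexHull_of_eq_bound _ k 0 hle hεu).1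
    rw [map_smul, smul_eq_mul] at this
    exact absurd (mul_pos hε hu) (not_lt.2 this)
  obtain ⟨v₀, ⟨hv₀, hkv₀⟩, hmin⟩ := Set.exists_min_image {v ∈ gens P | 0 < k v}
    (fun v => (1 - L' v) / k v) (gens_finite.subset fun _ h => h.1) hpos
  -- This is the largest tilt that keeps `L' + t • k ≤ 1` on the generators; there `v₀` becomes
  -- tight, against maximality.
  set t := (1 - L' v₀) / k v₀ with ht
  have ht0 : 0 ≤ t := div_nonneg (sub_nonneg.2 (hL' _ hv₀)) hkv₀.le
  have hsup : IsSupporting (L' + t • k) := fun v hv => by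
    simp only [LinearMap.add_apply, LinearMap.smul_apply, smul_eq_mul]
    rcases le_or_gt (k v) 0 with h | h
    · have := hL' v hv
      nlinarith
    · have := (le_div_iff₀ h).1 (hmin v ⟨hv, h⟩)
      linarith
  have htight : tight L' ⊆ tight (L' + t • k) := fun v hv =>
    ⟨hv.1, by simp [hkt v hv, hv.2]⟩
  have hv₀t : v₀ ∈ tight (L' + t • k) :=
    ⟨hv₀, by simp [ht, div_mul_cancel₀ _ hkv₀.ne']⟩
  have := hmax.le_of_ge (y := tight (L' + t • k)) ⟨_, hsup, hsub.trans htight, rfl⟩ htight hv₀t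
  exact hkv₀.ne' (hkt _ this)

/-- The differences lie in the kernel of `L`, and one vector with `L = 1` completes them to the
linear span. -/
theorem finrank_vectorSpan_add_one {E : Type*} [AddCommGroup E] [Module ℝ E]
    [FiniteDimensional ℝ E] (L : E →ₗ[ℝ] ℝ) {T : Set E} (hL : ∀ v ∈ T, L v = 1)
    (hT : T.Nonempty) :
    Module.finrank ℝ (vectorSpan ℝ T) + 1 = Module.finrank ℝ (Submodule.span ℝ T) := by
  obtain ⟨v₀, hv₀⟩ := hT
  have hker : vectorSpan ℝ T ≤ LinearMap.ker L := by
    rw [vectorSpan_def, Submodule.span_le]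
    rintro _ ⟨a, ha, b, hb, rfl⟩
    simp [hL a ha, hL b hb]
  have hv0 : v₀ ≠ 0 := fun h => by simpa [h] using hL v₀ hv₀
  have hsup : vectorSpan ℝ T ⊔ Submodule.span ℝ {v₀} = Submodule.span ℝ T := by
    apply le_antisymm
    · refine sup_le ?_ (Submodule.span_mono (Set.singleton_subset_iff.2 hv₀))
      rw [vectorSpan_def, Submodule.span_le]
      rintro _ ⟨a, ha, b, hb, rfl⟩
      exact sub_mem (Submodule.subset_span ha) (Submodule.subset_span hb)
    · rw [Submodule.span_le]
      intro v hv
      have : v = (v - v₀) + v₀ := by simp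
      rw [this]
      exact add_mem (Submodule.mem_sup_left (vsub_mem_vectorSpan ℝ hv hv₀))
        (Submodule.mem_sup_right (Submodule.mem_span_singleton_self _))
  have hinf : vectorSpan ℝ T ⊓ Submodule.span ℝ {v₀} = ⊥ := by
    rw [eq_bot_iff]
    rintro x ⟨hx, hx'⟩
    obtain ⟨c, rfl⟩ := Submodule.mem_span_singleton.1 hx'
    have := hker hx
    simp [hL v₀ hv₀] at this
    simp [this]
  have := Submodule.finrank_sup_add_finrank_inf_eq (vectorSpan ℝ T) (Submodule.span ℝ {v₀})
  rw [hsup, hinf, finrank_bot, finrank_span_singleton hv0] at this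
  lia

theorem vectorSpan_convexHull {E : Type*} [AddCommGroup E] [Module ℝ E] (S : Set E) :
    vectorSpan ℝ (convexHull ℝ S) = vectorSpan ℝ S := by
  rw [← direction_affineSpan, affineSpan_convexHull, direction_affineSpan]

theorem vectorSpan_polytope [Finite P] : vectorSpan ℝ (polytope P) = ⊤ := by
  have := Fintype.ofFinite P
  rw [← direction_affineSpan, convex_polytope.interior_nonempty_iff_affineSpan_eq_top.1
    ⟨0, zero_mem_interior_polytope⟩, AffineSubspace.direction_top]

theorem isFacet_convexHull_tight_iff [Finite P] {L : (P → ℝ) →ₗ[ℝ] ℝ} (hL : IsSupporting L)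
    (hne : (tight L).Nonempty) :
    IsFacet (polytope P) (convexHull ℝ (tight L)) ↔ Submodule.span ℝ (tight L) = ⊤ := by
  have h1 := finrank_vectorSpan_add_one L (T := tight L) (fun v hv => hv.2) hne
  rw [IsFacet, vectorSpan_convexHull, h1, vectorSpan_polytope, finrank_top]
  exact ⟨fun h => Submodule.eq_top_of_finrank_eq h.2.2,
    fun h => ⟨hL.isExposed, hne.convexHull, by rw [h, finrank_top]⟩⟩

theorem linearIndependent_toReal_basis {ι : Type*} [Finite ι]
    (b : Module.Basis ι ℤ (ι → ℤ)) :
    LinearIndependent ℝ fun i => toReal (b i) := by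
  classical
  have := Fintype.ofFinite ι
  refine linearIndependent_of_top_le_span_of_card_eq_finrank ?_ (by simp)
  have key : ∀ v : ι → ℤ, toReal v ∈ Submodule.span ℝ (Set.range fun i => toReal (b i)) := by
    intro v
    have : toReal v = ∑ i, (b.repr v i : ℝ) • toReal (b i) := by
      conv_lhs => rw [← b.sum_repr v]
      ext p
      simp [toReal, Finset.sum_apply]
    rw [this]
    exact Submodule.sum_mem _ fun i _ => Submodule.smul_mem _ _ (Submodule.subset_span ⟨i, rfl⟩)
  intro v _
  rw [pi_eq_sum_univ' v]
  refine Submodule.sum_mem _ fun p _ => Submodule.smul_mem _ _ ?_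
  convert key (Pi.single p 1) using 1
  ext j
  simp [toReal, Pi.single_apply]

/-- Smoothness only speaks of facets, so the face is first enlarged to one; independence passes to
subsets. -/
theorem IsSmoothFano.linearIndependent_tight [Finite P] (h : IsSmoothFano (polytope P))
    {L : (P → ℝ) →ₗ[ℝ] ℝ} (hL : IsSupporting L) :
    LinearIndependent ℝ ((↑) : tight L → (P → ℝ)) := by
  rcases (tight L).eq_empty_or_nonempty with hemp | hne
  · rw [hemp]; exact linearIndependent_empty ℝ _
  obtain ⟨L', hL', hsub, hspan⟩ := hL.exists_span_eq_top
  obtain ⟨b, hb⟩ := h.2 _ ((isFacet_convexHull_tight_iff hL' (hne.mono hsub)).2 hspan)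
  rw [extremePoints_convexHull_tight] at hb
  exact (linearIndependent_toReal_basis b).linearIndepOn_id.mono (hsub.trans hb.subset)

end Faces

end PosetFano

namespace PosetFano

open SimpleGraph

/-! ### From walks to linear relations and supporting functionals. -/

section Walks

variable {P : Type*} [PartialOrder P]

theorem rho_injective {x y a b : Hat P} (hxy : x ⋖ y) (hab : a ⋖ b) (h : rho x y = rho a b) :
    x = a ∧ y = b := by
  have h1 : ∀ p : P, x = ((p : WithTop P) : Hat P) ↔ a = ((p : WithTop P) : Hat P) := fun p => by
    rw [← rho_apply_eq_one_iff hxy, ← rho_apply_eq_one_iff hab, h]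
  have h2 : ∀ p : P, y = ((p : WithTop P) : Hat P) ↔ b = ((p : WithTop P) : Hat P) := fun p => by
    rw [← rho_apply_eq_neg_one_iff hxy, ← rho_apply_eq_neg_one_iff hab, h]
  have hx : x ≠ ⊤ := fun h => absurd hxy.lt (h ▸ not_top_lt)
  have ha : a ≠ ⊤ := fun h => absurd hab.lt (h ▸ not_top_lt)
  have hy : y ≠ ⊥ := fun h => absurd hxy.lt (h ▸ not_lt_bot)
  have hb : b ≠ ⊥ := fun h => absurd hab.lt (h ▸ not_lt_bot)
  constructor
  · rcases hat_cases x with rfl | hx' | ⟨p, hp⟩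
    · rcases hat_cases a with rfl | ha' | ⟨p, hp⟩
      · rfl
      · exact absurd ha' ha
      · rw [hp]; exact (h1 p).2 hp
    · exact absurd hx' hx
    · rw [hp]; exact ((h1 p).1 hp).symm
  · rcases hat_cases y with hy' | rfl | ⟨p, hp⟩
    · exact absurd hy' hy
    · rcases hat_cases b with hb' | rfl | ⟨p, hp⟩
      · exact absurd hb' hb
      · rfl
      · rw [hp]; exact (h2 p).2 hp
    · rw [hp]; exact ((h2 p).1 hp).symm

/-- The generators of the edges of the walk `w` all belong to `T`. -/
def EdgesIn {u v : Hat P} (w : (hatGraph P).Walk u v) (T : Set (P → ℝ)) : Prop :=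
  ∀ x y, x ⋖ y → s(x, y) ∈ w.edges → rho x y ∈ T

theorem EdgesIn.of_cons {u b v : Hat P} {h : (hatGraph P).Adj u b} {p : (hatGraph P).Walk b v}
    {T : Set (P → ℝ)} (hw : EdgesIn (Walk.cons h p) T) : EdgesIn p T :=
  fun x y hxy hm => hw x y hxy (by rw [Walk.edges_cons]; exact List.mem_cons_of_mem _ hm)

theorem EdgesIn.unitVec_sub_mem_span {u v : Hat P} {w : (hatGraph P).Walk u v}
    {T : Set (P → ℝ)} (hw : EdgesIn w T) : unitVec u - unitVec v ∈ Submodule.span ℝ T := by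
  induction w with
  | nil => simp
  | @cons u b v h p ih =>
    have h1 := ih hw.of_cons
    have h2 : unitVec u - unitVec b ∈ Submodule.span ℝ T := by
      rcases hasse_adj.1 h with hc | hc
      · exact Submodule.subset_span (hw u b hc (by simp))
      · rw [← neg_sub]
        exact neg_mem (Submodule.subset_span (hw b u hc (by simp [Sym2.eq_swap])))
    simpa using add_mem h2 h1

/-- As the ends have equal unit vectors, the rest of the walk writes the vector of the first edge,
up to sign, in terms of the other edges. This treats cycles and paths from `⊥` to `⊤` alike.
Distinct edges have distinct vectors by `rho_injective`, so the relation is not trivial. -/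
theorem EdgesIn.not_linearIndependent {u b v : Hat P} {h : (hatGraph P).Adj u b}
    {p : (hatGraph P).Walk b v} {T : Set (P → ℝ)} (hw : EdgesIn (Walk.cons h p) T)
    (hnot : s(u, b) ∉ p.edges) (huv : unitVec u = unitVec v) :
    ¬ LinearIndependent ℝ ((↑) : T → (P → ℝ)) := by
  intro hT
  have key : ∀ x y, x ⋖ y → s(x, y) = s(u, b) →
      rho x y ∈ Submodule.span ℝ {unitVec b - unitVec u} → False := by
    intro x y hxy he hmem
    have hin : rho x y ∈ T := hw x y hxy (by simp [he])
    have hp : EdgesIn p (T \ {rho x y}) := fun a c hac hm => by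
      refine ⟨hw.of_cons a c hac hm, fun heq => hnot ?_⟩
      obtain ⟨rfl, rfl⟩ := rho_injective hac hxy heq
      rwa [← he]
    have h1 := hp.unitVec_sub_mem_span
    rw [← huv] at h1
    have h2 : rho x y ∈ Submodule.span ℝ (T \ {rho x y}) :=
      (Submodule.span_singleton_le_iff_mem _ _).2 h1 hmem
    refine linearIndependent_iff_notMem_span.1 hT ⟨_, hin⟩ (Submodule.span_mono ?_ h2)
    rintro v ⟨hv, hne⟩
    exact ⟨⟨v, hv⟩, ⟨trivial, fun h => hne (congrArg Subtype.val h)⟩, rfl⟩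
  rcases hasse_adj.1 h with hc | hc
  · refine key u b hc rfl ?_
    rw [rho, ← neg_sub (unitVec b) (unitVec u)]
    exact Submodule.neg_mem _ (Submodule.mem_span_singleton_self _)
  · exact key b u hc Sym2.eq_swap (Submodule.mem_span_singleton_self _)

theorem EdgesIn.not_linearIndependent_of_isCycle {u : Hat P} {c : (hatGraph P).Walk u u}
    {T : Set (P → ℝ)} (hc : c.IsCycle) (hT : EdgesIn c T) :
    ¬ LinearIndependent ℝ ((↑) : T → (P → ℝ)) := by
  cases c with
  | nil => exact absurd rfl hc.ne_nil
  | cons h p => exact hT.not_linearIndependent ((Walk.cons_isCycle_iff _ _).1 hc).2 rfl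

theorem EdgesIn.not_linearIndependent_of_isPath {γ : (hatGraph P).Walk ⊥ ⊤}
    {T : Set (P → ℝ)} (hγ : γ.IsPath) (hT : EdgesIn γ T) :
    ¬ LinearIndependent ℝ ((↑) : T → (P → ℝ)) := by
  cases γ with
  | cons h p =>
    exact hT.not_linearIndependent (fun hm => ((Walk.cons_isPath_iff _ _).1 hγ).2
      (p.fst_mem_support_of_mem_edges hm)) (by simp)

theorem exists_isSupporting_of_potential [Finite P] (g : Hat P → ℤ)
    (hg : ∀ x y, x ⋖ y → g y - g x ≤ 1) (h : g ⊥ = g ⊤) :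
    ∃ L : (P → ℝ) →ₗ[ℝ] ℝ, IsSupporting L ∧ ∀ x y, L (rho x y) = g y - g x := by
  classical
  have := Fintype.ofFinite P
  let L : (P → ℝ) →ₗ[ℝ] ℝ := ∑ p : P,
    ((g ⊥ : ℝ) - g ((p : WithTop P) : Hat P)) • (LinearMap.proj p : (P → ℝ) →ₗ[ℝ] ℝ)
  have hL : ∀ x, L (unitVec x) = g ⊥ - g x := fun x => by
    rcases hat_cases x with rfl | rfl | ⟨p, rfl⟩
    · simp
    · simp [h]
    · rw [unitVec_coe]
      simp [L, LinearMap.sum_apply, Pi.single_apply]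
  have hL' : ∀ x y, L (rho x y) = g y - g x := fun x y => by
    rw [rho, map_sub, hL, hL]; ring
  refine ⟨L, ?_, hL'⟩
  rintro _ ⟨x, y, hxy, rfl⟩
  rw [hL']
  exact_mod_cast hg x y hxy

/-- A walk whose function `μ` is Lipschitz for the distance of `P̂` with its ends identified lies on
a face of `Q_P`. -/
theorem exists_isSupporting_of_isMu [Finite P] {u v : Hat P} {w : (hatGraph P).Walk u v}
    {μ : Hat P → ℕ} (hμ : IsMu w μ) (hd : DistIneq w μ) (m : ℤ)
    (h1 : ∀ x ∈ w.support, (μ x : ℤ) - m ≤ chainDist ⊥ x)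
    (h2 : ∀ y ∈ w.support, m - (μ y : ℤ) ≤ chainDist y ⊤)
    (h3 : ⊥ ∈ w.support → (μ ⊥ : ℤ) = m) (h4 : ⊤ ∈ w.support → (μ ⊤ : ℤ) = m) :
    ∃ L : (P → ℝ) →ₗ[ℝ] ℝ, IsSupporting L ∧ EdgesIn w (tight L) := by
  classical
  -- `m` is the common value prescribed at `⊥` and `⊤`; on the walk `ν` agrees with `μ` by `h3` and
  -- `h4`.
  let ν : Hat P → ℤ := fun x => if x = ⊥ ∨ x = ⊤ then m else μ x
  have hν : ∀ x ∈ w.support, ν x = μ x := fun x hx => by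
    by_cases hb : x = ⊥
    · subst hb; simp [ν, h3 hx]
    · by_cases ht : x = ⊤
      · subst ht; simp [ν, h4 hx]
      · simp [ν, hb, ht]
  have hνb : ν ⊥ = m := by simp [ν]
  have hνt : ν ⊤ = m := by simp [ν]
  obtain ⟨g, hg, hcov⟩ := exists_lipschitz_extension ({x | x ∈ w.support} ∪ {⊥, ⊤}) (by simp) ν (by
    rintro x (hx | rfl | rfl) y (hy | rfl | rfl) hlt
    · rw [hν x hx, hν y hy]; exact hd x hx y hy hlt
    · rw [hν x hx, hνb]; exact h1 x hx
    · exact absurd hlt not_top_lt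
    · exact absurd hlt not_lt_bot
    · exact absurd hlt not_lt_bot
    · exact absurd hlt not_top_lt
    · rw [hν y hy, hνt]; exact h2 y hy
    · rw [hνb, hνt]; simp
    · exact absurd hlt not_top_lt)
  obtain ⟨L, hL, hLe⟩ := exists_isSupporting_of_potential g hcov
    (by rw [hg ⊥ (by simp), hg ⊤ (by simp), hνb, hνt])
  refine ⟨L, hL, fun x y hxy he => ⟨⟨x, y, hxy, rfl⟩, ?_⟩⟩
  have hx := w.fst_mem_support_of_mem_edges he
  have hy := w.snd_mem_support_of_mem_edges he
  have hstep : μ y = μ x + 1 := by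
    obtain ⟨d, hd', hde⟩ := List.mem_map.1 he
    have hm := hμ.1 d hd'
    rcases (dart_edge_eq_mk'_iff' (d := d)).1 hde with ⟨rfl, rfl⟩ | ⟨rfl, rfl⟩
    · exact hm.1 hxy.lt
    · exact hm.2 hxy.lt
  rw [hLe, hg x (Or.inl hx), hg y (Or.inl hy), hν x hx, hν y hy, hstep]
  push_cast
  ring

theorem exists_isSupporting_of_isVerySpecialCycle [Finite P] {u : Hat P}
    {c : (hatGraph P).Walk u u} {μ : Hat P → ℕ} (hc : IsVerySpecialCycle c) (hμ : IsMu c μ)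
    (hd : DistIneq c μ) (he : EndsIneq c μ) :
    ∃ L : (P → ℝ) →ₗ[ℝ] ℝ, IsSupporting L ∧ EdgesIn c (tight L) := by
  by_cases hb : ⊥ ∈ c.support
  · refine exists_isSupporting_of_isMu hμ hd (μ ⊥) (fun x hx => ?_) (fun y hy => ?_) (fun _ => rfl)
      fun ht => absurd ⟨hb, ht⟩ hc.2.2
    · rcases eq_or_ne x ⊥ with rfl | hne
      · simp
      · exact hd x hx ⊥ hb (bot_lt_iff_ne_bot.2 hne)
    · simpa [chainDist_self] using he ⊥ hb y hy
  by_cases ht : ⊤ ∈ c.support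
  · refine exists_isSupporting_of_isMu hμ hd (μ ⊤) (fun x hx => ?_) (fun y hy => ?_)
      (fun h => absurd h hb) fun _ => rfl
    · simpa [chainDist_self] using he x hx ⊤ ht
    · rcases eq_or_ne y ⊤ with rfl | hne
      · simp
      · exact hd ⊤ ht y hy (lt_top_iff_ne_top.2 hne)
  -- A cycle avoiding both ends leaves `m` free, subject to `μ x - dist(⊥, x) ≤ m ≤ μ y + dist(y,
  -- ⊤)` for all vertices. `EndsIneq` says exactly that such an `m` exists; the least upper end is
  -- taken.
  obtain ⟨z, hz, hmin⟩ := Set.exists_min_image {x | x ∈ c.support}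
    (fun y => (μ y : ℤ) + chainDist y ⊤) (Set.toFinite _) ⟨u, c.start_mem_support⟩
  refine exists_isSupporting_of_isMu hμ hd (μ z + chainDist z ⊤) (fun x hx => ?_) (fun y hy => ?_)
      (fun h => absurd h hb) fun h => absurd h ht
  · have := he x hx z hz
    linarith
  · have := hmin y hy
    linarith

theorem exists_isSupporting_of_isSpecial [Finite P] {γ : (hatGraph P).Walk ⊥ ⊤} {μ : Hat P → ℕ}
    (hs : IsSpecial γ) (hμ : IsMu γ μ) (hd : DistIneq γ μ) :
    ∃ L : (P → ℝ) →ₗ[ℝ] ℝ, IsSupporting L ∧ EdgesIn γ (tight L) := by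
  have htop : (μ ⊤ : ℤ) = μ ⊥ := by
    have h1 := telescope γ (fun x => (μ x : ℤ)) fun d hd => by
      have h := hμ.1 d hd
      rcases hat_lt_or_gt d with hlt | hlt
      · simp [stepSign, hlt, h.1 hlt]
      · simp [stepSign, hlt.not_gt, h.2 hlt]
    rw [sum_stepSign, hs, sub_self] at h1
    linarith
  refine exists_isSupporting_of_isMu hμ hd (μ ⊥) (fun x hx => ?_) (fun y hy => ?_) (fun _ => rfl)
    fun _ => htop
  · rcases eq_or_ne x ⊥ with rfl | hne
    · simp
    · exact hd x hx ⊥ γ.start_mem_support (bot_lt_iff_ne_bot.2 hne)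
  · rcases eq_or_ne y ⊤ with rfl | hne
    · simp [htop]
    · rw [← htop]
      exact hd ⊤ γ.end_mem_support y hy (lt_top_iff_ne_top.2 hne)

end Walks

/-! ### Walks whose edges lie on a face. -/

section TightWalks

variable {P : Type*} [PartialOrder P]

theorem telescope_real {u v : Hat P} (w : (hatGraph P).Walk u v) (f : Hat P → ℝ)
    (hf : ∀ d ∈ w.darts, f d.snd - f d.fst = stepSign d) :
    f v - f u = ((w.darts.map stepSign).sum : ℤ) := by
  induction w with
  | nil => simp
  | cons h p ih =>
    have h1 := ih (fun d hd => hf d (by simp [hd]))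
    have h2 := hf ⟨(_, _), h⟩ (by simp)
    simp only [Walk.darts_cons, List.map_cons, List.sum_cons]
    rw [Int.cast_add]
    simp only at h2
    linarith

theorem eq_of_forall_darts {V α : Type*} {G : SimpleGraph V} {u v : V} (w : G.Walk u v) (f : V → α)
    (hf : ∀ d ∈ w.darts, f d.snd = f d.fst) : ∀ x ∈ w.support, f x = f u := by
  induction w with
  | nil => simp
  | cons h p ih =>
    intro x hx
    rw [Walk.support_cons, List.mem_cons] at hx
    rcases hx with rfl | hx
    · rfl
    · rw [ih (fun d hd => hf d (by simp [hd])) x hx]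
      exact hf ⟨(_, _), h⟩ (by simp)

variable {L : (P → ℝ) →ₗ[ℝ] ℝ} {u v : Hat P} {w : (hatGraph P).Walk u v}

theorem EdgesIn.sub_eq_stepSign (hw : EdgesIn w (tight L)) {d : (hatGraph P).Dart}
    (hd : d ∈ w.darts) : L (unitVec d.fst) - L (unitVec d.snd) = stepSign d := by
  have he : s(d.fst, d.snd) ∈ w.edges := List.mem_map.2 ⟨d, hd, rfl⟩
  rcases hasse_adj.1 d.adj with hc | hc
  · have := (hw _ _ hc he).2
    rw [rho, map_sub] at this
    simp [stepSign, hc.lt, this]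
  · have := (hw _ _ hc (Sym2.eq_swap ▸ he)).2
    rw [rho, map_sub] at this
    simp only [stepSign, hc.lt.not_gt, if_false]
    push_cast
    linarith

theorem EdgesIn.isSpecial (hw : EdgesIn w (tight L)) (huv : unitVec u = unitVec v) :
    IsSpecial w := by
  have h := telescope_real w (fun x => -L (unitVec x)) fun d hd => by
    rw [← hw.sub_eq_stepSign hd]; ring
  rw [huv, sub_self, sum_stepSign] at h
  have h0 := Int.cast_eq_zero.1 h.symm
  rw [IsSpecial]
  lia

/-- Each step changes `μ` and `-L ∘ unitVec` by the same amount, so they differ by a constant on the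
walk. -/
theorem EdgesIn.mu_sub_mu (hw : EdgesIn w (tight L)) {μ : Hat P → ℕ} (hμ : IsMu w μ)
    {x y : Hat P} (hx : x ∈ w.support) (hy : y ∈ w.support) :
    (μ x : ℝ) - μ y = L (unitVec y) - L (unitVec x) := by
  have h := eq_of_forall_darts w (fun z => (μ z : ℝ) + L (unitVec z)) fun d hd => by
    have h1 := hw.sub_eq_stepSign hd
    have h2 := hμ.1 d hd
    rcases hat_lt_or_gt d with hlt | hlt
    · have := h2.1 hlt
      simp only [stepSign, hlt, if_true] at h1
      push_cast at h1
      rw [this]; push_cast; linarith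
    · have := h2.2 hlt
      simp only [stepSign, hlt.not_gt, if_false] at h1
      push_cast at h1
      rw [this]; push_cast; linarith
  have := h x hx
  have := h y hy
  linarith

theorem IsSupporting.sub_le_chainDist [Finite P] (hL : IsSupporting L) {x y : Hat P} (h : y ≤ x) :
    L (unitVec y) - L (unitVec x) ≤ chainDist y x := by
  have := PosetFano.sub_le_chainDist (f := fun z => -L (unitVec z)) (fun a b hab => by
    have := hL _ ⟨a, b, hab, rfl⟩
    rw [rho, map_sub] at this
    linarith) h
  linarith

theorem EdgesIn.distIneq [Finite P] (hw : EdgesIn w (tight L)) (hL : IsSupporting L)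
    {μ : Hat P → ℕ} (hμ : IsMu w μ) : DistIneq w μ := fun x hx y hy hlt => by
  have h := hL.sub_le_chainDist hlt.le
  rw [← hw.mu_sub_mu hμ hx hy] at h
  exact_mod_cast h

theorem EdgesIn.endsIneq [Finite P] (hw : EdgesIn w (tight L)) (hL : IsSupporting L)
    {μ : Hat P → ℕ} (hμ : IsMu w μ) : EndsIneq w μ := fun x hx y hy => by
  have h1 := hL.sub_le_chainDist (bot_le (a := x))
  have h2 := hL.sub_le_chainDist (le_top (a := y))
  have h3 := hw.mu_sub_mu hμ hx hy
  simp only [unitVec_bot, unitVec_top, map_zero] at h1 h2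
  have : (μ x : ℝ) - μ y ≤ chainDist ⊥ x + chainDist y ⊤ := by linarith
  exact_mod_cast this

end TightWalks

end PosetFano

namespace PosetFano

open SimpleGraph

/-! ### From linear relations to cycles and paths. -/

section SupportGraph

variable {P : Type*} [PartialOrder P]

/-- The edges of the Hasse diagram of `P̂` whose generators have a nonzero coefficient in `l`. -/
def coeffGraph (l : (P → ℝ) →₀ ℝ) : SimpleGraph (Hat P) where
  Adj x y := (x ⋖ y ∧ l (rho x y) ≠ 0) ∨ (y ⋖ x ∧ l (rho y x) ≠ 0)
  symm := ⟨fun _ _ h => h.symm⟩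
  loopless := ⟨fun _ h => h.elim (fun h => h.1.lt.ne rfl) fun h => h.1.lt.ne rfl⟩

theorem coeffGraph_le (l : (P → ℝ) →₀ ℝ) : coeffGraph l ≤ hatGraph P := fun _ _ h =>
  hasse_adj.2 (h.imp And.left And.left)

/-- In a linear relation among the generators, no element of `P` meets exactly one edge. -/
theorem not_existsUnique_coeffGraph_adj {l : (P → ℝ) →₀ ℝ} (hl : ∀ v ∈ l.support, v ∈ gens P)
    (h0 : Finsupp.linearCombination ℝ id l = 0) {p : P} {b : Hat P}
    (hb : (coeffGraph l).Adj ((p : WithTop P) : Hat P) b)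
    (huniq : ∀ b', (coeffGraph l).Adj ((p : WithTop P) : Hat P) b' → b' = b) : False := by
  -- In coordinate `p` only edges at `p` contribute; a single such edge would leave one nonzero
  -- term.
  have hsum : ∑ v ∈ l.support, l v * v p = 0 := by
    have := congrFun h0 p
    rw [Finsupp.linearCombination_apply, Finsupp.sum] at this
    simpa [Finset.sum_apply] using this
  have key : ∀ x y, x ⋖ y → l (rho x y) ≠ 0 → rho x y p ≠ 0 →
      (∀ a c, a ⋖ c → l (rho a c) ≠ 0 → rho a c p ≠ 0 → rho a c = rho x y) → False := by
    intro x y _ hne hp h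
    rw [Finset.sum_eq_single (rho x y) (fun v hv hvne => ?_) (fun hv => ?_)] at hsum
    · exact mul_ne_zero hne hp hsum
    · obtain ⟨a, c, hac, rfl⟩ := hl v hv
      by_contra hcon
      exact hvne (h a c hac (left_ne_zero_of_mul hcon) (right_ne_zero_of_mul hcon))
    · rw [Finsupp.notMem_support_iff.1 hv, zero_mul]
  have hcase : ∀ a c : Hat P, a ⋖ c → rho a c p ≠ 0 →
      a = ((p : WithTop P) : Hat P) ∨ c = ((p : WithTop P) : Hat P) := fun a c _ hne => by
    by_contra! hcon
    exact hne (by simp [rho, unitVec, hcon.1, hcon.2])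
  have hend : ∀ a c : Hat P, a ⋖ c → l (rho a c) ≠ 0 → rho a c p ≠ 0 →
      (a = ((p : WithTop P) : Hat P) ∧ c = b) ∨ (c = ((p : WithTop P) : Hat P) ∧ a = b) := by
    intro a c hac hlne hne
    rcases hcase a c hac hne with rfl | rfl
    · exact Or.inl ⟨rfl, huniq c (Or.inl ⟨hac, hlne⟩)⟩
    · exact Or.inr ⟨rfl, huniq a (Or.inr ⟨hac, hlne⟩)⟩
  rcases hb with ⟨hc, hlne⟩ | ⟨hc, hlne⟩
  · refine key _ _ hc hlne ?_ fun a c hac h1 h2 => ?_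
    · rw [(rho_apply_eq_one_iff hc p).2 rfl]; norm_num
    · rcases hend a c hac h1 h2 with ⟨rfl, rfl⟩ | ⟨rfl, rfl⟩
      · rfl
      · exact absurd hac.lt hc.lt.not_gt
  · refine key _ _ hc hlne ?_ fun a c hac h1 h2 => ?_
    · rw [(rho_apply_eq_neg_one_iff hc p).2 rfl]; norm_num
    · rcases hend a c hac h1 h2 with ⟨rfl, rfl⟩ | ⟨rfl, rfl⟩
      · exact absurd hac.lt hc.lt.not_gt
      · rfl

/-- A nontrivial finite acyclic graph has two different leaves in one component. -/
theorem exists_reachable_leaves {V : Type*} [Finite V] {G : SimpleGraph V} (hG : G.IsAcyclic)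
    {a b : V} (hab : G.Adj a b) :
    ∃ u v, u ≠ v ∧ G.Reachable u v ∧ (∃ c, G.Adj u c ∧ ∀ c', G.Adj u c' → c' = c) ∧
      ∃ c, G.Adj v c ∧ ∀ c', G.Adj v c' → c' = c := by
  have : Nonempty V := ⟨a⟩
  -- The ends of a longest path are leaves: another neighbour would extend the path or close a
  -- cycle.
  obtain ⟨u, v, p, hp, hmax⟩ := Walk.exists_isPath_forall_isPath_length_le_length G
  have hnil : ¬ p.Nil := fun h => by
    have h1 := hmax a b (Walk.cons hab Walk.nil) (by simp [hab.ne])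
    have h2 := Walk.length_eq_zero_iff.2 h
    simp [h2] at h1
  refine ⟨u, v, hp.nil_iff_eq.not.mp hnil, p.reachable, ⟨_, p.adj_snd hnil, fun w hadj => ?_⟩,
    ⟨_, (p.adj_penultimate hnil).symm, fun w hadj => ?_⟩⟩
  · apply hG.eq_snd_of_adj_start hp hadj
    have : ¬ (p.cons hadj.symm).IsPath := fun h => by
      have := hmax _ _ _ h
      simp at this
    by_contra hw
    exact this (hp.cons hw)
  · apply hG.eq_penultimate_of_adj_end hp hadj
    have : ¬ (p.concat hadj).IsPath := fun h => by
      have := hmax _ _ _ h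
      simp at this
    by_contra hw
    exact this (hp.concat hw hadj)

/-- A linear relation among the generators involves a cycle of the Hasse diagram of `P̂` or a path
from `⊥` to `⊤`. -/
theorem exists_isCycle_or_isPath [Finite P] {T : Set (P → ℝ)} (hT : T ⊆ gens P)
    (h : ¬ LinearIndependent ℝ ((↑) : T → (P → ℝ))) :
    (∃ (u : Hat P) (c : (hatGraph P).Walk u u), c.IsCycle ∧ EdgesIn c T ∧
      ¬ (⊥ ∈ c.support ∧ ⊤ ∈ c.support)) ∨
      ∃ γ : (hatGraph P).Walk ⊥ ⊤, γ.IsPath ∧ EdgesIn γ T := by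
  classical
  rw [linearIndependent_subtype_iff, linearIndepOn_iff] at h
  push Not at h
  obtain ⟨l, hlT, h0, hne⟩ := h
  rw [Finsupp.mem_supported] at hlT
  have hedges : ∀ {u v : Hat P} (w : (coeffGraph l).Walk u v), EdgesIn (w.mapLe (coeffGraph_le l)) T := by
    intro u v w x y hxy he
    rw [Walk.edges_mapLe_eq_edges] at he
    have hadj : (coeffGraph l).Adj x y := w.adj_of_mem_edges he
    rcases hadj with ⟨_, hl⟩ | ⟨hc, _⟩
    · exact hlT (Finsupp.mem_support_iff.2 hl)
    · exact absurd hc.lt hxy.lt.not_gt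
  by_cases hr : (coeffGraph l).Reachable ⊥ ⊤
  · obtain ⟨w, hw⟩ := hr.exists_isPath
    exact Or.inr ⟨_, hw.mapLe _, hedges w⟩
  left
  by_contra hcon
  have hacyc : (coeffGraph l).IsAcyclic := fun u c hc => by
    refine hcon ⟨u, _, hc.mapLe (coeffGraph_le l), hedges c, fun hbt => hr ?_⟩
    rw [Walk.support_mapLe_eq_support] at hbt
    exact (c.takeUntil _ hbt.1).reachable.symm.trans (c.takeUntil _ hbt.2).reachable
  obtain ⟨v, hv⟩ := Finsupp.support_nonempty_iff.2 hne
  obtain ⟨x, y, hxy, rfl⟩ := hT (hlT hv)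
  obtain ⟨a, b, hab, hreach, ⟨a', ha', ha⟩, ⟨b', hb', hb⟩⟩ := exists_reachable_leaves hacyc
    (show (coeffGraph l).Adj x y from Or.inl ⟨hxy, Finsupp.mem_support_iff.1 hv⟩)
  have hsub : ∀ v ∈ l.support, v ∈ gens P := fun v hv => hT (hlT hv)
  -- Two distinct leaves in one component cannot be `⊥` and `⊤`, which are not connected. So one of
  -- them lies in `P`, where no leaf is possible.
  rcases hat_cases a with rfl | rfl | ⟨p, rfl⟩
  · rcases hat_cases b with rfl | rfl | ⟨q, rfl⟩
    · exact hab rfl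
    · exact hr hreach
    · exact not_existsUnique_coeffGraph_adj hsub h0 hb' hb
  · rcases hat_cases b with rfl | rfl | ⟨q, rfl⟩
    · exact hr hreach.symm
    · exact hab rfl
    · exact not_existsUnique_coeffGraph_adj hsub h0 hb' hb
  · exact not_existsUnique_coeffGraph_adj hsub h0 ha' ha

end SupportGraph

/-! ### Unimodularity and smoothness. -/

section Basis

variable {P : Type*} [PartialOrder P]

theorem toReal_injective {ι : Type*} : Function.Injective (toReal (ι := ι)) := fun v w h => by
  ext i
  exact Int.cast_injective (congrFun h i)

/-- The generators on a face are totally unimodular: if they form a basis of `ℝ^P`, then they form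
a `ℤ`-basis of `ℤ^P`. -/
theorem exists_intBasis_of_span_tight [Finite P] {L : (P → ℝ) →ₗ[ℝ] ℝ}
    (hli : LinearIndependent ℝ ((↑) : tight L → (P → ℝ)))
    (hspan : Submodule.span ℝ (tight L) = ⊤) :
    ∃ b : Module.Basis P ℤ (P → ℤ), tight L = Set.range fun i => toReal (b i) := by
  classical
  have := Fintype.ofFinite P
  let T : Set (P → ℤ) := {v | toReal v ∈ tight L}
  have hT : tight L = toReal '' T := by
    ext v
    refine ⟨fun hv => ?_, ?_⟩
    · obtain ⟨x, y, hxy, rfl⟩ := hv.1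
      exact ⟨_, by simpa [T, toReal_intUnitVec_sub] using hv, toReal_intUnitVec_sub x y⟩
    · rintro ⟨v, hv, rfl⟩
      exact hv
  have hliT : LinearIndependent ℤ ((↑) : T → (P → ℤ)) := by
    have hcomp : LinearIndependent ℝ fun v : T => toReal (v : P → ℤ) :=
      hli.comp (fun v : T => (⟨toReal v, v.2⟩ : tight L)) fun v w h =>
        Subtype.ext (toReal_injective (congrArg Subtype.val h))
    rw [linearIndependent_iff'] at hcomp ⊢
    intro s g hg i hi
    have := hcomp s (fun v => (g v : ℝ)) (by
      ext p
      have := congrFun hg p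
      simp only [Finset.sum_apply, Pi.smul_apply, smul_eq_mul, Pi.zero_apply] at this
      simp only [Finset.sum_apply, Pi.smul_apply, smul_eq_mul, Pi.zero_apply, toReal]
      exact_mod_cast this) i hi
    exact_mod_cast this
  have hmem : ∀ p : P, intUnitVec ((p : WithTop P) : Hat P) ∈ Submodule.span ℤ T := by
    -- `k` is the indicator of the elements whose unit vector is not in the `ℤ`-span of `T`. The two
    -- ends of a tight edge are both inside or both outside, so `k` kills the tight generators.
    -- These span, hence `k = 0` and every unit vector is in the `ℤ`-span.
    let C : P → ℝ := fun p => if intUnitVec ((p : WithTop P) : Hat P) ∈ Submodule.span ℤ T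
      then 0 else 1
    let k : (P → ℝ) →ₗ[ℝ] ℝ := ∑ p, C p • (LinearMap.proj p : (P → ℝ) →ₗ[ℝ] ℝ)
    have hk : ∀ x : Hat P, k (unitVec x) = if intUnitVec x ∈ Submodule.span ℤ T then 0 else 1 := by
      intro x
      rcases hat_cases x with rfl | rfl | ⟨p, rfl⟩
      · have : intUnitVec (⊥ : Hat P) = 0 := by ext p; simp [intUnitVec]
        simp [this]
      · have : intUnitVec (⊤ : Hat P) = 0 := toReal_injective (by
          have h := toReal_intUnitVec_sub (⊤ : Hat P) ⊥
          have hb : intUnitVec (⊥ : Hat P) = 0 := by ext p; simp [intUnitVec]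
          rw [hb, sub_zero] at h
          rw [h]
          ext p
          simp [rho, toReal])
        simp [this]
      · rw [unitVec_coe]
        simp only [k, LinearMap.sum_apply, LinearMap.smul_apply, LinearMap.proj_apply,
          Pi.single_apply, smul_eq_mul, mul_ite, mul_one, mul_zero, Finset.sum_ite_eq',
          Finset.mem_univ, if_true]
        rfl
    have hk0 : k = 0 := by
      refine LinearMap.ext_on hspan ?_
      intro v hv
      obtain ⟨x, y, hxy, rfl⟩ := hv.1
      have hd : intUnitVec x - intUnitVec y ∈ Submodule.span ℤ T :=
        Submodule.subset_span (by simpa [T, toReal_intUnitVec_sub] using hv)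
      have hiff : intUnitVec x ∈ Submodule.span ℤ T ↔ intUnitVec y ∈ Submodule.span ℤ T :=
        ⟨fun h => by simpa using sub_mem h hd, fun h => by simpa using add_mem hd h⟩
      simp [rho, hk, hiff]
    intro p
    by_contra hp
    have := hk ((p : WithTop P) : Hat P)
    simp [hk0, hp] at this
  have hspanT : ⊤ ≤ Submodule.span ℤ (Set.range ((↑) : T → (P → ℤ))) := by
    rw [Subtype.range_coe]
    intro v _
    rw [pi_eq_sum_univ' v]
    refine Submodule.sum_mem _ fun p _ => Submodule.smul_mem _ _ ?_
    convert hmem p using 1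
    ext j
    simp [intUnitVec, Pi.single_apply, eq_comm]
  let b := Module.Basis.mk hliT hspanT
  let e := b.indexEquiv (Pi.basisFun ℤ P)
  refine ⟨b.reindex e, ?_⟩
  rw [hT]
  ext v
  constructor
  · rintro ⟨v, hv, rfl⟩
    exact ⟨e ⟨v, hv⟩, by simp [b]⟩
  · rintro ⟨i, rfl⟩
    exact ⟨e.symm i, (e.symm i).2, by simp [b]⟩

theorem isSmoothFano_polytope [Finite P] (h : ∀ L : (P → ℝ) →ₗ[ℝ] ℝ, IsSupporting L →
    LinearIndependent ℝ ((↑) : tight L → (P → ℝ))) : IsSmoothFano (polytope P) := by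
  refine ⟨isFano_polytope, fun F hF => ?_⟩
  have hFQ : F ≠ polytope P := by
    rintro rfl
    have := hF.2.2
    lia
  obtain ⟨L, hL, rfl⟩ := exists_isSupporting_of_isExposed hF.1 hF.2.1 hFQ
  rw [extremePoints_convexHull_tight]
  exact exists_intBasis_of_span_tight (h L hL)
    ((isFacet_convexHull_tight_iff hL (convexHull_nonempty_iff.1 hF.2.1)).1 hF)

end Basis

end PosetFano

/-! ### The equivalence, with every condition compared to independence of tight sets. -/

theorem mainTheorem1 (P : Type*) [PartialOrder P] [Finite P] :
    List.TFAE [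
      PosetFano.IsQFactorialFano (PosetFano.polytope P),
      PosetFano.IsSmoothFano (PosetFano.polytope P),
      (¬ ∃ (u : PosetFano.Hat P) (c : (PosetFano.hatGraph P).Walk u u) (μ : PosetFano.Hat P → ℕ),
          PosetFano.IsVerySpecialCycle c ∧ PosetFano.IsMu c μ ∧
            PosetFano.DistIneq c μ ∧ PosetFano.EndsIneq c μ) ∧
        (¬ ∃ (γ : (PosetFano.hatGraph P).Walk ⊥ ⊤) (μ : PosetFano.Hat P → ℕ),
          γ.IsPath ∧ PosetFano.IsSpecial γ ∧ PosetFano.IsMu γ μ ∧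
            PosetFano.DistIneq γ μ)] := by
  rw [PosetFano.isQFactorialFano_polytope_iff]
  tfae_have 1 → 2 := PosetFano.isSmoothFano_polytope
  tfae_have 2 → 1 := fun h L hL => h.linearIndependent_tight hL
  tfae_have 1 → 3 := by
    refine fun h => ⟨?_, ?_⟩
    · rintro ⟨u, c, μ, hc, hμ, hd, he⟩
      obtain ⟨L, hL, hT⟩ := PosetFano.exists_isSupporting_of_isVerySpecialCycle hc hμ hd he
      exact hT.not_linearIndependent_of_isCycle hc.1 (h L hL)
    · rintro ⟨γ, μ, hγ, hs, hμ, hd⟩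
      obtain ⟨L, hL, hT⟩ := PosetFano.exists_isSupporting_of_isSpecial hs hμ hd
      exact hT.not_linearIndependent_of_isPath hγ (h L hL)
  tfae_have 3 → 1 := by
    intro h L hL
    by_contra hcon
    rcases PosetFano.exists_isCycle_or_isPath (fun _ hv => hv.1) hcon with
      ⟨u, c, hc, hT, hbt⟩ | ⟨γ, hγ, hT⟩
    · have hs := hT.isSpecial rfl
      obtain ⟨μ, hμ⟩ := PosetFano.exists_isMu_of_isCycle c hc hs
      exact h.1 ⟨u, c, μ, ⟨hc, hs, hbt⟩, hμ, hT.distIneq hL hμ, hT.endsIneq hL hμ⟩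
    · obtain ⟨μ, hμ⟩ := PosetFano.exists_isMu_of_isPath γ hγ
      exact h.2 ⟨γ, μ, hγ, hT.isSpecial (by simp), hμ, hT.distIneq hL hμ⟩
  tfae_finish
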